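/- Let $X$ be a separable infinite-dimensional complex Banach space and let $\Gamma\subset\mathbb{C}$ be unbounded. Then there is a bounded linear operator $T:X\to X$ that is frequently $\Gamma$-supercyclic, and hence also $\mathcal{U}$-frequently $\Gamma$-supercyclic and reiteratively $\Gamma$-supercyclic. Here, for $x\in X$ and $U\subset X$, put $\mathcal{N}_T(\Gamma x,U)=\{n\in\mathbb{N}_0 : T^n(\Gamma x)\cap U\neq\emptyset\}$, where $\Gamma x=\{\gamma x:\gamma\in\Gamma\}$. The operator $T$ is frequently (respectively $\mathcal{U}$-frequently, reiteratively) $\Gamma$-supercyclic if there exists $x\in X$ such that for every non-empty open set $U\subset X$ the set $E=\mathcal{N}_T(\Gamma x,U)$ has positive lower asymptotic density $\underline{d}(E)$ (respectively positive upper asymptotic density $\overline{d}(E)$, positive upper Banach density $\overline{b}(E)$), where $$\underline{d}(E)=\liminf_{n\to\infty}\frac{\#(E\cap[0,n])}{n},\qquad \overline{d}(E)=\limsup_{n\to\infty}\frac{\#(E\cap[0,n])}{n},\qquad \overline{b}(E)=\lim_{s\to\infty}\Bigl[\limsup_{k\to\infty}\frac{\#(E\cap[k+1,k+s])}{s}\Bigr].$$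 -/

import Mathlib

open Filter Topology

namespace LinearDynamics

noncomputable section

/-- The lower asymptotic density of a set of non-negative integers. The sequence lies in `[0, 2]`,
so the real `liminf` is the genuine one; the term `n = 0` plays no role. -/
def lowerDensity (E : Set ℕ) : ℝ :=
  liminf (fun n : ℕ => ((E ∩ Set.Icc 0 n).ncard : ℝ) / (n : ℝ)) atTop

/-- The upper asymptotic density of a set of non-negative integers. -/
def upperDensity (E : Set ℕ) : ℝ :=
  limsup (fun n : ℕ => ((E ∩ Set.Icc 0 n).ncard : ℝ) / (n : ℝ)) atTop

/-- The quantity `limsup_k #(E ∩ [k+1, k+s]) / s` attached to windows of length `s`. -/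
def windowDensity (E : Set ℕ) (s : ℕ) : ℝ :=
  limsup (fun k : ℕ => ((E ∩ Set.Icc (k + 1) (k + s)).ncard : ℝ) / (s : ℝ)) atTop

/-- The upper Banach density: the limit of `windowDensity E s` as `s → ∞`. The limit exists for
every `E`, see `tendsto_windowDensity`. -/
def upperBanachDensity (E : Set ℕ) : ℝ :=
  limUnder atTop (windowDensity E)

lemma ncard_window_le (E : Set ℕ) (s k : ℕ) : (E ∩ Set.Icc (k + 1) (k + s)).ncard ≤ s := by
  refine (Set.ncard_le_ncard Set.inter_subset_right (Set.finite_Icc _ _)).trans ?_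
  rw [← Finset.coe_Icc, Set.ncard_coe_finset, Nat.card_Icc]
  omega

lemma window_bddAbove (E : Set ℕ) (s : ℕ) (f : ℕ → ℕ) :
    IsBoundedUnder (· ≤ ·) atTop
      (fun k : ℕ => ((E ∩ Set.Icc (f k + 1) (f k + s)).ncard : ℝ)) :=
  isBoundedUnder_of ⟨s, fun k => by exact_mod_cast ncard_window_le E s (f k)⟩

lemma window_bddBelow (E : Set ℕ) (s : ℕ) (f : ℕ → ℕ) :
    IsBoundedUnder (· ≥ ·) atTop
      (fun k : ℕ => ((E ∩ Set.Icc (f k + 1) (f k + s)).ncard : ℝ)) :=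
  isBoundedUnder_of ⟨0, fun _ => Nat.cast_nonneg _⟩

/-- `limsup_k #(E ∩ [k+1, k+s])`. -/
def windowCount (E : Set ℕ) (s : ℕ) : ℝ :=
  limsup (fun k : ℕ => ((E ∩ Set.Icc (k + 1) (k + s)).ncard : ℝ)) atTop

lemma windowDensity_eq (E : Set ℕ) (s : ℕ) : windowDensity E s = windowCount E s / s := by
  have hm : Monotone (fun x : ℝ => x / (s : ℝ)) := fun a b h => by
    dsimp only; gcongr
  have := hm.map_limsup_of_continuousAt (F := atTop)
    (fun k : ℕ => ((E ∩ Set.Icc (k + 1) (k + s)).ncard : ℝ))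
    (continuous_id.div_const _).continuousAt
    (window_bddAbove E s id)
    (window_bddBelow E s id).isCoboundedUnder_le
  exact this.symm

lemma windowCount_subadditive (E : Set ℕ) : Subadditive (windowCount E) := by
  intro s t
  have hshift : windowCount E t =
      limsup (fun k : ℕ => ((E ∩ Set.Icc ((k + s) + 1) ((k + s) + t)).ncard : ℝ)) atTop :=
    (limsup_nat_add (fun k : ℕ => ((E ∩ Set.Icc (k + 1) (k + t)).ncard : ℝ)) s).symm
  rw [hshift]
  have hle : ∀ k : ℕ, ((E ∩ Set.Icc (k + 1) (k + (s + t))).ncard : ℝ) ≤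
      ((E ∩ Set.Icc (k + 1) (k + s)).ncard : ℝ) +
        ((E ∩ Set.Icc ((k + s) + 1) ((k + s) + t)).ncard : ℝ) := by
    intro k
    have hsub : E ∩ Set.Icc (k + 1) (k + (s + t)) ⊆
        (E ∩ Set.Icc (k + 1) (k + s)) ∪ (E ∩ Set.Icc ((k + s) + 1) ((k + s) + t)) := by
      rintro n ⟨hn, h1, h2⟩
      rcases le_or_gt n (k + s) with h | h
      · exact Or.inl ⟨hn, h1, h⟩
      · exact Or.inr ⟨hn, h, by omega⟩
    have hfin : ((E ∩ Set.Icc (k + 1) (k + s)) ∪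
        (E ∩ Set.Icc ((k + s) + 1) ((k + s) + t))).Finite :=
      ((Set.finite_Icc _ _).subset Set.inter_subset_right).union
        ((Set.finite_Icc _ _).subset Set.inter_subset_right)
    exact_mod_cast (Set.ncard_le_ncard hsub hfin).trans (Set.ncard_union_le _ _)
  have hb1 := window_bddAbove E s id
  have hb2 := window_bddAbove E t (fun k => k + s)
  have hc1 := window_bddBelow E s id
  have hc2 := window_bddBelow E t (fun k => k + s)
  calc windowCount E (s + t) ≤ limsup ((fun k : ℕ =>
        ((E ∩ Set.Icc (k + 1) (k + s)).ncard : ℝ)) + (fun k : ℕ =>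
        ((E ∩ Set.Icc ((k + s) + 1) ((k + s) + t)).ncard : ℝ))) atTop :=
        limsup_le_limsup (Eventually.of_forall hle)
          (window_bddBelow E (s + t) id).isCoboundedUnder_le (isBoundedUnder_le_add hb1 hb2)
    _ ≤ _ := limsup_add_le hc1 hb1 hc2.isCoboundedUnder_le hb2

/-- The limit in the definition of the upper Banach density always exists. -/
theorem tendsto_windowDensity (E : Set ℕ) :
    Tendsto (windowDensity E) atTop (𝓝 (upperBanachDensity E)) := by
  have hnn : ∀ s, 0 ≤ windowCount E s := fun s =>
    le_limsup_of_frequently_le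
      (Frequently.of_forall fun _ => Nat.cast_nonneg _) (window_bddAbove E s id)
  have h := (windowCount_subadditive E).tendsto_lim
    ⟨0, by rintro _ ⟨n, rfl⟩; exact div_nonneg (hnn n) (Nat.cast_nonneg _)⟩
  have heq : windowDensity E = fun s => windowCount E s / s := funext (windowDensity_eq E)
  exact tendsto_nhds_limUnder ⟨_, heq ▸ h⟩

/-- The family of sets of positive lower asymptotic density. -/
def posLowerDensity : Set (Set ℕ) := {E | 0 < lowerDensity E}

/-- The family of sets of positive upper asymptotic density. -/
def posUpperDensity : Set (Set ℕ) := {E | 0 < upperDensity E}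

/-- The family of sets of positive upper Banach density. -/
def posUpperBanachDensity : Set (Set ℕ) := {E | 0 < upperBanachDensity E}

variable {X : Type*} [NormedAddCommGroup X] [NormedSpace ℂ X]

/-- The set of return times `{n ≥ 0 : T ^ n (Γ x) ∩ U ≠ ∅}`. -/
def returnTimes (T : X →L[ℂ] X) (Γ : Set ℂ) (x : X) (U : Set X) : Set ℕ :=
  {n | ((fun y => (T ^ n) y) '' ((fun γ : ℂ => γ • x) '' Γ) ∩ U).Nonempty}

/-- `T` is `ℱ_Γ`-hypercyclic: for some `x`, every non-empty open set has its set of return times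
in the family `ℱ`. -/
def IsHypercyclicFor (F : Set (Set ℕ)) (Γ : Set ℂ) (T : X →L[ℂ] X) : Prop :=
  ∃ x : X, ∀ U : Set X, IsOpen U → U.Nonempty → returnTimes T Γ x U ∈ F

/-- Frequently `Γ`-supercyclic operators. -/
def FrequentlySupercyclic (Γ : Set ℂ) (T : X →L[ℂ] X) : Prop :=
  IsHypercyclicFor posLowerDensity Γ T

/-- `𝒰`-frequently `Γ`-supercyclic operators. -/
def UFrequentlySupercyclic (Γ : Set ℂ) (T : X →L[ℂ] X) : Prop :=
  IsHypercyclicFor posUpperDensity Γ T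

/-- Reiteratively `Γ`-supercyclic operators. -/
def ReiterativelySupercyclic (Γ : Set ℂ) (T : X →L[ℂ] X) : Prop :=
  IsHypercyclicFor posUpperBanachDensity Γ T

end

end LinearDynamics

/-! On the span `D` of a biorthogonal sequence with dense span, a weighted backward shift `T` is
onto and locally nilpotent (`exists_dense_generalized_kernel`). Choose targets `y j` in `D`, with
dense range and killed by `T ^ (j + 1)`, times `r n = returnSeq n`, and preimages `z n` of `y (v₂(n
+ 1))` under `T ^ r n`. Put `x = ∑ (γ n)⁻¹ • z n` with `γ n ∈ Γ` growing fast, which is possible as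
`Γ` is unbounded. In `γ m • T ^ r m x` the terms `n < m` vanish because the gaps of `r` exceed the
nilpotency orders, the term `n = m` is the target, and the terms `n > m` are tiny
(`exists_orbit_approx`). Each valuation `j` recurs along an arithmetic progression and `r n ≤ 2 *
n`, so each target is approached with positive lower density. The other two notions follow by
comparing densities. -/

namespace LinearDynamics

/-! ### Comparison of densities -/

section Density

lemma ncard_inter_Icc_le (E : Set ℕ) (n : ℕ) : (E ∩ Set.Icc 0 n).ncard ≤ n + 1 := by
  refine (Set.ncard_le_ncard Set.inter_subset_right (Set.finite_Icc _ _)).trans ?_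
  rw [← Finset.coe_Icc, Set.ncard_coe_finset, Nat.card_Icc]
  omega

lemma density_quotient_nonneg (E : Set ℕ) (n : ℕ) :
    0 ≤ ((E ∩ Set.Icc 0 n).ncard : ℝ) / (n : ℝ) := by positivity

lemma density_quotient_le_two (E : Set ℕ) (n : ℕ) :
    ((E ∩ Set.Icc 0 n).ncard : ℝ) / (n : ℝ) ≤ 2 := by
  rcases Nat.eq_zero_or_pos n with rfl | hn
  · simp
  · have h : ((E ∩ Set.Icc 0 n).ncard : ℝ) ≤ n + 1 := by exact_mod_cast ncard_inter_Icc_le E n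
    have h1 : (1 : ℝ) ≤ n := by exact_mod_cast hn
    rw [div_le_iff₀ (by linarith)]
    linarith

lemma density_isBoundedUnder_le (E : Set ℕ) : IsBoundedUnder (· ≤ ·) atTop
    (fun n : ℕ => ((E ∩ Set.Icc 0 n).ncard : ℝ) / (n : ℝ)) :=
  isBoundedUnder_of ⟨2, density_quotient_le_two E⟩

lemma density_isBoundedUnder_ge (E : Set ℕ) : IsBoundedUnder (· ≥ ·) atTop
    (fun n : ℕ => ((E ∩ Set.Icc 0 n).ncard : ℝ) / (n : ℝ)) :=
  isBoundedUnder_of ⟨0, density_quotient_nonneg E⟩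

lemma lowerDensity_le_upperDensity (E : Set ℕ) : lowerDensity E ≤ upperDensity E :=
  liminf_le_limsup (density_isBoundedUnder_le E) (density_isBoundedUnder_ge E)

lemma posLowerDensity_subset_posUpperDensity : posLowerDensity ⊆ posUpperDensity :=
  fun E hE => lt_of_lt_of_le hE (lowerDensity_le_upperDensity E)

lemma ncard_le_of_windows {E : Set ℕ} {s K : ℕ} {c : ℝ}
    (h : ∀ k ≥ K, ((E ∩ Set.Icc (k + 1) (k + s)).ncard : ℝ) ≤ c) (t : ℕ) :
    ((E ∩ Set.Icc 0 (K + t * s)).ncard : ℝ) ≤ K + 1 + t * c := by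
  induction t with
  | zero =>
    have := ncard_inter_Icc_le E K
    simp only [zero_mul, add_zero, Nat.cast_zero]
    exact_mod_cast this
  | succ t ih =>
    have hsub : E ∩ Set.Icc 0 (K + (t + 1) * s) ⊆ (E ∩ Set.Icc 0 (K + t * s)) ∪
        (E ∩ Set.Icc (K + t * s + 1) (K + t * s + s)) := by
      rintro n ⟨hn, h1, h2⟩
      rcases le_or_gt n (K + t * s) with h | h
      · exact Or.inl ⟨hn, h1, h⟩
      · exact Or.inr ⟨hn, h, by rw [add_mul] at h2; omega⟩
    have hfin : ((E ∩ Set.Icc 0 (K + t * s)) ∪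
        (E ∩ Set.Icc (K + t * s + 1) (K + t * s + s))).Finite :=
      ((Set.finite_Icc _ _).subset Set.inter_subset_right).union
        ((Set.finite_Icc _ _).subset Set.inter_subset_right)
    have h1 : ((E ∩ Set.Icc 0 (K + (t + 1) * s)).ncard : ℝ) ≤
        ((E ∩ Set.Icc 0 (K + t * s)).ncard : ℝ) +
          ((E ∩ Set.Icc (K + t * s + 1) (K + t * s + s)).ncard : ℝ) := by
      exact_mod_cast (Set.ncard_le_ncard hsub hfin).trans (Set.ncard_union_le _ _)
    have h2 := h (K + t * s) (by omega)
    push_cast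
    linarith

/-- If all late windows were sparser than `c / 2`, tiling an initial segment by them would
contradict the lower bound `c * n`. -/
lemma le_windowDensity {E : Set ℕ} {c : ℝ} (hc : 0 < c)
    (h : ∀ᶠ n : ℕ in atTop, c * n ≤ ((E ∩ Set.Icc 0 n).ncard : ℝ)) {s : ℕ} (hs : 0 < s) :
    c / 2 ≤ windowDensity E s := by
  have hs' : (0 : ℝ) < s := by exact_mod_cast hs
  rw [windowDensity_eq, le_div_iff₀ hs']
  refine le_limsup_of_frequently_le ?_ (window_bddAbove E s id)
  by_contra hcon
  rw [not_frequently, eventually_atTop] at hcon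
  obtain ⟨K, hK⟩ := hcon
  have hwin := ncard_le_of_windows (E := E) (s := s) (K := K) (c := c / 2 * s)
    fun k hk => (not_le.1 (hK k hk)).le
  obtain ⟨N, hN⟩ := eventually_atTop.1 h
  -- Enough tiles for the surplus `t * (c / 2 * s)` to beat the `K + 1` points before the tiling.
  obtain ⟨t, ht⟩ := exists_nat_gt (max (N : ℝ) ((K + 1) / (c / 2 * s)))
  have htN : N ≤ t := by exact_mod_cast ((le_max_left _ _).trans_lt ht).le
  have ht2 := (le_max_right _ _).trans_lt ht
  rw [div_lt_iff₀ (by positivity)] at ht2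
  have hle : N ≤ K + t * s := by nlinarith
  have h1 := hN _ hle
  have h2 := hwin t
  push_cast at h1
  have h3 : 0 ≤ c * K := by positivity
  nlinarith

lemma posLowerDensity_subset_posUpperBanachDensity :
    posLowerDensity ⊆ posUpperBanachDensity := by
  intro E hE
  have hE' : 0 < lowerDensity E := hE
  have hev := eventually_lt_of_lt_liminf (half_lt_self hE') (density_isBoundedUnder_ge E)
  have hc : ∀ᶠ n : ℕ in atTop, lowerDensity E / 2 * n ≤ ((E ∩ Set.Icc 0 n).ncard : ℝ) := by
    filter_upwards [hev, eventually_gt_atTop 0] with n hn hn0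
    exact ((lt_div_iff₀ (by exact_mod_cast hn0)).1 hn).le
  have hlim : lowerDensity E / 2 / 2 ≤ upperBanachDensity E := by
    refine ge_of_tendsto (tendsto_windowDensity E) ?_
    filter_upwards [eventually_gt_atTop 0] with s hs
    exact le_windowDensity (by positivity) hc hs
  exact lt_of_lt_of_le (by positivity) hlim

/-- A set containing the values of an injective sequence of linear growth has positive lower
density. -/
lemma mem_posLowerDensity_of_linear_growth {E : Set ℕ} {b : ℕ → ℕ} (hb : Function.Injective b)
    {C : ℕ} (hC : ∀ k, b k ≤ C * (k + 1)) (hE : ∀ k, b k ∈ E) : E ∈ posLowerDensity := by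
  have hpos : 0 < C := by
    by_contra h
    have h0 : C = 0 := by omega
    subst h0
    have := @hb 0 1 (by have := hC 0; have := hC 1; omega)
    omega
  have hC' : (0 : ℝ) < C := by exact_mod_cast hpos
  -- For `n ≥ 2 * C`, rounding `n / C` down loses at most half of it.
  have key : ∀ᶠ n : ℕ in atTop, (1 / (2 * C) : ℝ) ≤ ((E ∩ Set.Icc 0 n).ncard : ℝ) / (n : ℝ) := by
    filter_upwards [eventually_ge_atTop (2 * C)] with n hn
    have hn0 : (0 : ℝ) < n := by
      have : 0 < n := by omega
      exact_mod_cast this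
    have hsub : b '' ((Finset.range (n / C) : Finset ℕ) : Set ℕ) ⊆ E ∩ Set.Icc 0 n := by
      rintro _ ⟨k, hk, rfl⟩
      refine ⟨hE k, Nat.zero_le _, (hC k).trans ?_⟩
      have hk' : k + 1 ≤ n / C := by simpa using hk
      exact (Nat.mul_le_mul_left C hk').trans (Nat.mul_div_le n C)
    have h1 := Set.ncard_le_ncard hsub ((Set.finite_Icc _ _).subset Set.inter_subset_right)
    rw [Set.ncard_image_of_injective _ hb, Set.ncard_coe_finset, Finset.card_range] at h1
    have h2 : n < C * (n / C + 1) := Nat.lt_mul_div_succ n hpos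
    have h2' : (n : ℝ) < C * (((n / C : ℕ) : ℝ) + 1) := by exact_mod_cast h2
    have h1' : ((n / C : ℕ) : ℝ) ≤ ((E ∩ Set.Icc 0 n).ncard : ℝ) := by exact_mod_cast h1
    have hn' : (2 * C : ℝ) ≤ n := by exact_mod_cast hn
    rw [div_le_div_iff₀ (by positivity) hn0]
    nlinarith
  exact lt_of_lt_of_le (by positivity)
    (le_liminf_of_le (density_isBoundedUnder_le E).isCoboundedUnder_ge key)

end Density

/-! ### Return times with controlled gaps -/

section ReturnSequence

/-- A strictly increasing sequence of linear growth whose gap after the `n`-th term exceeds the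
2-adic valuation of `n + 1`. -/
def returnSeq (n : ℕ) : ℕ := n + padicValNat 2 n.factorial

lemma returnSeq_succ (n : ℕ) :
    returnSeq (n + 1) = returnSeq n + (padicValNat 2 (n + 1) + 1) := by
  have : Fact (Nat.Prime 2) := ⟨Nat.prime_two⟩
  unfold returnSeq
  rw [Nat.factorial_succ, padicValNat.mul (by omega) (Nat.factorial_ne_zero n)]
  omega

lemma returnSeq_strictMono : StrictMono returnSeq :=
  strictMono_nat_of_lt_succ fun n => by rw [returnSeq_succ]; omega

lemma returnSeq_gap {n m : ℕ} (h : n < m) :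
    returnSeq n + (padicValNat 2 (n + 1) + 1) ≤ returnSeq m := by
  rw [← returnSeq_succ]
  exact returnSeq_strictMono.monotone h

/-- Legendre: `v₂(n!)` is `n` minus the binary digit sum of `n`. -/
lemma returnSeq_le (n : ℕ) : returnSeq n ≤ 2 * n := by
  have : Fact (Nat.Prime 2) := ⟨Nat.prime_two⟩
  have h := sub_one_mul_padicValNat_factorial (p := 2) n
  unfold returnSeq
  omega

/-- Returns indexed by the integers `n ≥ M` with `v₂(n + 1) = j` form a set of positive lower
density. -/
lemma mem_posLowerDensity_of_returnSeq {E : Set ℕ} (j M : ℕ)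
    (h : ∀ n ≥ M, padicValNat 2 (n + 1) = j → returnSeq n ∈ E) : E ∈ posLowerDensity := by
  have : Fact (Nat.Prime 2) := ⟨Nat.prime_two⟩
  have hp : 0 < 2 ^ j := by positivity
  -- `i k + 1` is `2 ^ j` times an odd number; the shift by `M` forces `i k ≥ M`.
  let i : ℕ → ℕ := fun k => 2 ^ j * (2 * (k + M) + 1) - 1
  have hi : ∀ k, i k + 1 = 2 ^ j * (2 * (k + M) + 1) := fun k => by
    have : 0 < 2 ^ j * (2 * (k + M) + 1) := by positivity
    simp only [i]; omega
  have hval : ∀ k, padicValNat 2 (i k + 1) = j := fun k => by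
    rw [hi, padicValNat.mul hp.ne' (by omega), padicValNat.prime_pow,
      padicValNat.eq_zero_of_not_dvd (by omega), add_zero]
  refine mem_posLowerDensity_of_linear_growth (b := fun k => returnSeq (i k))
    (C := 2 * (2 ^ j * (2 * M + 2))) ?_ ?_ ?_
  · refine returnSeq_strictMono.injective.comp fun k l hkl => ?_
    have h1 : 2 ^ j * (2 * (k + M) + 1) = 2 ^ j * (2 * (l + M) + 1) := by
      rw [← hi, ← hi]; exact congrArg (· + 1) hkl
    have := Nat.eq_of_mul_eq_mul_left hp h1
    omega
  · intro k
    have h1 := returnSeq_le (i k)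
    have h2 := hi k
    have h3 : 2 ^ j * (2 * (k + M) + 1) ≤ 2 ^ j * ((2 * M + 2) * (k + 1)) :=
      Nat.mul_le_mul_left _ (by nlinarith)
    calc returnSeq (i k) ≤ 2 * (i k) := h1
      _ ≤ 2 * (2 ^ j * ((2 * M + 2) * (k + 1))) := by omega
      _ = _ := by ring
  · intro k
    refine h _ ?_ (hval k)
    have h2 := hi k
    have h3 : 1 * (2 * (k + M) + 1) ≤ 2 ^ j * (2 * (k + M) + 1) := Nat.mul_le_mul_right _ hp
    omega

end ReturnSequence

/-! ### Supercyclicity from a dense generalized kernel -/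

section Criterion

variable {X : Type*} [NormedAddCommGroup X] [NormedSpace ℂ X]

lemma exists_rapidly_growing_seq {Γ : Set ℂ} (hΓ : ¬ Bornology.IsBounded Γ) (M : ℕ → ℝ) :
    ∃ γ : ℕ → ℂ, (∀ n, γ n ∈ Γ) ∧ (∀ n, γ n ≠ 0) ∧ (∀ n, M n ≤ ‖γ n‖) ∧
      ∀ m n, m < n → M n * ‖γ m‖ ≤ ‖γ n‖ := by
  have hg : ∀ R : ℝ, ∃ γ ∈ Γ, R < ‖γ‖ := by
    intro R
    by_contra! h
    exact hΓ (isBounded_iff_forall_norm_le.2 ⟨R, h⟩)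
  choose g hgΓ hgn using hg
  -- Factors at least `1` keep the norms monotone and nonzero, so comparing consecutive terms
  -- suffices.
  let B : ℕ → ℝ := fun n => max (M n) 1
  let γ : ℕ → ℂ := fun n =>
    Nat.rec (g (B 0)) (fun n z => g (B (n + 1) * (‖z‖ + 1))) n
  have hγ0 : γ 0 = g (B 0) := rfl
  have hγs : ∀ n, γ (n + 1) = g (B (n + 1) * (‖γ n‖ + 1)) := fun n => rfl
  have hB : ∀ n, 1 ≤ B n := fun n => le_max_right _ _
  have hs : ∀ n, B (n + 1) * (‖γ n‖ + 1) < ‖γ (n + 1)‖ := fun n => by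
    rw [hγs n]; exact hgn _
  have hBle : ∀ n, B n < ‖γ n‖ := by
    intro n
    cases n with
    | zero => exact hgn _
    | succ n =>
      have := hs n
      have := hB (n + 1)
      nlinarith [norm_nonneg (γ n)]
  have hmono : Monotone fun n => ‖γ n‖ := monotone_nat_of_le_succ fun n => by
    have := hs n
    have := hB (n + 1)
    nlinarith [norm_nonneg (γ n)]
  refine ⟨γ, ?_, ?_, fun n => (le_max_left _ _).trans (hBle n).le, ?_⟩
  · intro n
    cases n with
    | zero => exact hgΓ _
    | succ n => exact hgΓ _
  · intro n h
    have h1 := hBle n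
    have h2 := hB n
    rw [h, norm_zero] at h1
    linarith
  · intro m n hmn
    cases n with
    | zero => omega
    | succ n =>
      have h1 : ‖γ m‖ ≤ ‖γ n‖ := hmono (Nat.lt_succ_iff.1 hmn)
      have h2 := hs n
      have h3 := hB (n + 1)
      have h4 : M (n + 1) ≤ B (n + 1) := le_max_left _ _
      calc M (n + 1) * ‖γ m‖ ≤ B (n + 1) * ‖γ m‖ := by gcongr
        _ ≤ B (n + 1) * (‖γ n‖ + 1) := by gcongr; linarith
        _ ≤ _ := h2.le

lemma pow_apply_eq_zero_of_le {T : X →L[ℂ] X} {v : X} {k n : ℕ} (hkn : k ≤ n)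
    (h : (T ^ k) v = 0) : (T ^ n) v = 0 := by
  obtain ⟨d, rfl⟩ := Nat.exists_eq_add_of_le' hkn
  rw [pow_add, mul_apply_eq_comp, h, map_zero]

/-- Simultaneous approximation of a sequence of targets along the return sequence by multiples of
the orbit of a single vector. -/
lemma exists_orbit_approx [CompleteSpace X] (T : X →L[ℂ] X) {Γ : Set ℂ}
    (hΓ : ¬ Bornology.IsBounded Γ) (y : ℕ → X) (hy : ∀ j, (T ^ (j + 1)) (y j) = 0)
    (hpre : ∀ j n, ∃ z, (T ^ n) z = y j) :
    ∃ x : X, ∀ m, ∃ γ ∈ Γ,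
      ‖(T ^ returnSeq m) (γ • x) - y (padicValNat 2 (m + 1))‖ ≤ 2 * (1 / 2 : ℝ) ^ m := by
  choose z hz using fun n => hpre (padicValNat 2 (n + 1)) (returnSeq n)
  let M : ℕ → ℝ := fun n =>
    -- The first summand makes the series for `x` converge; the sum controls `z n` at all earlier
    -- return times.
    2 ^ n * (‖z n‖ + ∑ m ∈ Finset.range n, ‖(T ^ returnSeq m) (z n)‖)
  obtain ⟨γ, hγΓ, hγ0, hγM, hγ⟩ := exists_rapidly_growing_seq hΓ M
  have hnpos : ∀ n, 0 < ‖γ n‖ := fun n => norm_pos_iff.2 (hγ0 n)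
  have hgeo : Summable fun n : ℕ => (1 / 2 : ℝ) ^ n := summable_geometric_two
  have hzle : ∀ n, 2 ^ n * ‖z n‖ ≤ M n := fun n => by
    have : 0 ≤ ∑ m ∈ Finset.range n, ‖(T ^ returnSeq m) (z n)‖ :=
      Finset.sum_nonneg fun _ _ => norm_nonneg _
    simp only [M]
    gcongr
    linarith
  have hTle : ∀ m n, m < n → 2 ^ n * ‖(T ^ returnSeq m) (z n)‖ ≤ M n := fun m n hmn => by
    have h1 := Finset.single_le_sum (f := fun m => ‖(T ^ returnSeq m) (z n)‖)
      (fun _ _ => norm_nonneg _) (Finset.mem_range.2 hmn)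
    have h2 := norm_nonneg (z n)
    simp only [M]
    gcongr
    linarith
  have hterm : ∀ n, ‖(γ n)⁻¹ • z n‖ ≤ (1 / 2 : ℝ) ^ n := fun n => by
    rw [norm_smul, norm_inv, inv_mul_le_iff₀ (hnpos n), one_div, inv_pow, ← div_eq_mul_inv,
      le_div_iff₀ (by positivity), mul_comm]
    exact (hzle n).trans (hγM n)
  have hsum : Summable fun n => (γ n)⁻¹ • z n := Summable.of_norm_bounded hgeo hterm
  refine ⟨∑' n, (γ n)⁻¹ • z n, fun m => ⟨γ m, hγΓ m, ?_⟩⟩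
  let L : X →L[ℂ] X := γ m • (T ^ returnSeq m)
  have hL : (T ^ returnSeq m) (γ m • ∑' n, (γ n)⁻¹ • z n) = ∑' n, L ((γ n)⁻¹ • z n) := by
    rw [map_smul, ← L.map_tsum hsum]
    rfl
  have hLm : L ((γ m)⁻¹ • z m) = y (padicValNat 2 (m + 1)) := by
    simp only [L, smul_apply, map_smul, hz]
    rw [smul_smul, inv_mul_cancel₀ (hγ0 m), one_smul]
  have hLsum : Summable fun n => L ((γ n)⁻¹ • z n) := L.summable hsum
  have hbound : ∀ n, ‖(if n = m then 0 else L ((γ n)⁻¹ • z n))‖ ≤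
      if n < m + 1 then 0 else (1 / 2 : ℝ) ^ n := by
    intro n
    rcases lt_trichotomy n m with h | h | h
    · rw [if_neg h.ne, if_pos (by omega)]
      -- By time `returnSeq m`, `z n` has reached its target and been pushed on long enough to be
      -- killed.
      obtain ⟨d, hd⟩ := Nat.exists_eq_add_of_le (returnSeq_gap h)
      have hT : (T ^ returnSeq m) (z n) = 0 := by
        rw [hd, show returnSeq n + (padicValNat 2 (n + 1) + 1) + d =
          d + ((padicValNat 2 (n + 1) + 1) + returnSeq n) by ring, pow_add, pow_add]
        simp only [mul_apply_eq_comp, hz, hy, map_zero]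
      simp [L, hT]
    · simp [h]
    · rw [if_neg h.ne', if_neg (by omega)]
      rw [map_smul, norm_smul, norm_inv, smul_apply, norm_smul, inv_mul_le_iff₀ (hnpos n), one_div, inv_pow, ← div_eq_mul_inv,
        le_div_iff₀ (by positivity)]
      calc ‖γ m‖ * ‖(T ^ returnSeq m) (z n)‖ * 2 ^ n
          = (2 ^ n * ‖(T ^ returnSeq m) (z n)‖) * ‖γ m‖ := by ring
        _ ≤ M n * ‖γ m‖ := by gcongr; exact hTle m n h
        _ ≤ _ := hγ m n h
  have htail : HasSum (fun n => if n < m + 1 then 0 else (1 / 2 : ℝ) ^ n)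
      (2 * (1 / 2 : ℝ) ^ (m + 1)) := by
    rw [← hasSum_nat_add_iff' (m + 1)]
    have h0 : ∑ i ∈ Finset.range (m + 1), (if i < m + 1 then 0 else (1 / 2 : ℝ) ^ i) = 0 :=
      Finset.sum_eq_zero fun i hi => if_pos (Finset.mem_range.1 hi)
    have h1 : (fun n : ℕ => if n + (m + 1) < m + 1 then 0 else (1 / 2 : ℝ) ^ (n + (m + 1))) =
        fun n => (1 / 2 : ℝ) ^ n * (1 / 2 : ℝ) ^ (m + 1) := by
      funext n
      rw [if_neg (by omega), pow_add]
    rw [h0, sub_zero, h1]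
    exact hasSum_geometric_two.mul_right _
  rw [hL, hLsum.tsum_eq_add_tsum_ite m, hLm, add_sub_cancel_left]
  refine (tsum_of_norm_bounded htail hbound).trans ?_
  rw [pow_succ]
  have : (0 : ℝ) ≤ (1 / 2) ^ m := by positivity
  linarith

/-- If a dense subspace is mapped onto itself by `T` and every vector of it is killed by a power of
`T`, then `T` is frequently `Γ`-supercyclic for every unbounded `Γ`. -/
theorem frequentlySupercyclic_of_dense_generalized_kernel [CompleteSpace X]
    [TopologicalSpace.SeparableSpace X] (T : X →L[ℂ] X) (D : Submodule ℂ X)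
    (hD : Dense (D : Set X)) (hsurj : ∀ y ∈ D, ∃ z ∈ D, T z = y)
    (hnil : ∀ y ∈ D, ∃ k, (T ^ k) y = 0) {Γ : Set ℂ} (hΓ : ¬ Bornology.IsBounded Γ) :
    FrequentlySupercyclic Γ T := by
  classical
  have : SecondCountableTopology X := UniformSpace.secondCountable_of_separable X
  obtain ⟨u, hu⟩ := TopologicalSpace.exists_dense_seq D
  -- `u i` is listed at index `j` only if `T ^ (j + 1)` already kills it; the second coordinate of
  -- `j` is there to make `j` large.
  let y : ℕ → D := fun j =>
    if (T ^ (j + 1)) (u j.unpair.1 : X) = 0 then u j.unpair.1 else 0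
  have hy : ∀ j, (T ^ (j + 1)) (y j : X) = 0 := by
    intro j
    simp only [y]
    split_ifs with h
    · exact h
    · simp
  have hpre : ∀ n, ∀ v ∈ D, ∃ z ∈ D, (T ^ n) z = v := by
    intro n
    induction n with
    | zero => exact fun v hv => ⟨v, hv, rfl⟩
    | succ n ih =>
      intro v hv
      obtain ⟨z, hz, rfl⟩ := hsurj v hv
      obtain ⟨w, hw, rfl⟩ := ih z hz
      exact ⟨w, hw, by rw [pow_succ']; rfl⟩
  obtain ⟨x, hx⟩ := exists_orbit_approx T hΓ (fun j => (y j : X)) hy fun j n =>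
    (hpre n _ (y j).2).imp fun _ h => h.2
  refine ⟨x, fun U hU hUne => ?_⟩
  obtain ⟨v, hvU, hvD⟩ := hD.inter_open_nonempty U hU hUne
  obtain ⟨i, hi⟩ := hu.exists_mem_open (hU.preimage continuous_subtype_val) ⟨⟨v, hvD⟩, hvU⟩
  obtain ⟨ε, hε, hball⟩ := Metric.isOpen_iff.1 hU _ hi
  obtain ⟨k, hk⟩ := hnil _ (u i).2
  have hyj : y (Nat.pair i k) = u i := by
    simp only [y, Nat.unpair_pair]
    exact if_pos (pow_apply_eq_zero_of_le ((Nat.right_le_pair i k).trans (Nat.le_succ _)) hk)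
  have hlim : Tendsto (fun m : ℕ => 2 * (1 / 2 : ℝ) ^ m) atTop (𝓝 0) := by
    simpa using (tendsto_pow_atTop_nhds_zero_of_lt_one (r := (1 / 2 : ℝ)) (by norm_num)
      (by norm_num)).const_mul 2
  obtain ⟨M, hM⟩ := eventually_atTop.1 (hlim.eventually_lt_const hε)
  refine mem_posLowerDensity_of_returnSeq (Nat.pair i k) M fun n hn hval => ?_
  obtain ⟨γ, hγ, happ⟩ := hx n
  rw [hval, hyj] at happ
  refine ⟨(T ^ returnSeq n) (γ • x), ⟨γ • x, ⟨γ, hγ, rfl⟩, rfl⟩, hball ?_⟩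
  rw [mem_ball_iff_norm]
  exact happ.trans_lt (hM n hn)

end Criterion

/-! ### Biorthogonal sequences and the backward shift -/

section Biorthogonal

variable {X : Type*} [NormedAddCommGroup X] [NormedSpace ℂ X]

/-- A finite basis for the span of a countable dense set would make that span closed, hence all of
`X`. -/
lemma exists_linearIndependent_seq_dense_span [TopologicalSpace.SeparableSpace X]
    (hX : ¬ FiniteDimensional ℂ X) :
    ∃ v : ℕ → X, LinearIndependent ℂ v ∧ Dense (Submodule.span ℂ (Set.range v) : Set X) := by
  obtain ⟨s, hsc, hsd⟩ := TopologicalSpace.exists_countable_dense X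
  obtain ⟨b, hbs, hspan, hli⟩ := exists_linearIndependent ℂ s
  have hd : Dense (Submodule.span ℂ b : Set X) := by
    rw [hspan]
    exact hsd.mono Submodule.subset_span
  have hinf : b.Infinite := by
    intro hfin
    have hfd : FiniteDimensional ℂ (Submodule.span ℂ b) := FiniteDimensional.span_of_finite ℂ hfin
    have hcl : IsClosed (Submodule.span ℂ b : Set X) := Submodule.closed_of_finiteDimensional _
    have htop : Submodule.span ℂ b = ⊤ := by
      rw [← SetLike.coe_set_eq, Submodule.top_coe, ← hcl.closure_eq, hd.closure_eq]
    rw [htop] at hfd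
    exact hX (Module.finite_def.2 (Module.Finite.iff_fg.1 hfd))
  have hcb : Countable b := (hsc.mono hbs).to_subtype
  have hib : Infinite b := hinf.to_subtype
  obtain ⟨φ⟩ := nonempty_equiv_of_countable (α := ℕ) (β := b)
  refine ⟨fun n => (φ n : X), hli.comp φ φ.injective, ?_⟩
  have : Set.range (fun n => (φ n : X)) = b := by
    rw [show (fun n => (φ n : X)) = Subtype.val ∘ φ from rfl, φ.surjective.range_comp,
      Subtype.range_coe]
  rwa [this]

lemma exists_triangular_functionals {v : ℕ → X} (hv : LinearIndependent ℂ v) (n : ℕ) :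
    ∃ g : X →L[ℂ] ℂ, g (v n) = 1 ∧ ∀ k < n, g (v k) = 0 := by
  obtain ⟨f, hf, hfp⟩ := Submodule.exists_le_ker_of_notMem
    (hv.notMem_span_image (s := Set.Iio n) (x := n) (by simp))
  let q : Submodule ℂ X := Submodule.span ℂ (v '' Set.Iic n)
  have hfd : FiniteDimensional ℂ q :=
    FiniteDimensional.span_of_finite ℂ ((Set.finite_Iic n).image v)
  have hq : ∀ k ≤ n, v k ∈ q := fun k hk => Submodule.subset_span ⟨k, hk, rfl⟩
  -- `f` is only algebraic: its restriction to the finite-dimensional `q` is continuous and extends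
  -- by Hahn–Banach.
  obtain ⟨g, hg, -⟩ := exists_extension_norm_eq q (f.comp q.subtype).toContinuousLinearMap
  have hgv : ∀ k ≤ n, g (v k) = f (v k) := fun k hk => hg ⟨v k, hq k hk⟩
  refine ⟨(f (v n))⁻¹ • g, ?_, fun k hk => ?_⟩
  · simp [hgv n le_rfl, hf]
  · have h0 : f (v k) = 0 := hfp (Submodule.subset_span ⟨k, hk, rfl⟩)
    simp [hgv k hk.le, h0]

/-- A separable infinite-dimensional normed space has a biorthogonal sequence with dense span. -/
theorem exists_biorthogonal_seq_dense_span [TopologicalSpace.SeparableSpace X]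
    (hX : ¬ FiniteDimensional ℂ X) :
    ∃ (e : ℕ → X) (g : ℕ → X →L[ℂ] ℂ), (∀ i j, g i (e j) = if i = j then 1 else 0) ∧
      Dense (Submodule.span ℂ (Set.range e) : Set X) := by
  obtain ⟨v, hli, hd⟩ := exists_linearIndependent_seq_dense_span hX
  choose g hg1 hg0 using exists_triangular_functionals hli
  -- Gram–Schmidt with the `g k` as coordinates: the subtraction cancels `g i (v n)` for `i < n`,
  -- while triangularity handles `i > n`.
  have hrec : ∃ e : ℕ → X, ∀ n, e n = v n - ∑ k ∈ Finset.range n, g k (v n) • e k := by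
    let F : (n : ℕ) → ((m : ℕ) → m < n → X) → X := fun n ih =>
      v n - ∑ k : Fin n, g k (v n) • ih k k.2
    refine ⟨fun n => WellFounded.fix Nat.lt_wfRel.wf F n, fun n => ?_⟩
    dsimp only
    rw [WellFounded.fix_eq, Finset.sum_range]
  obtain ⟨e, he⟩ := hrec
  have hlow : ∀ n i, n < i → g i (e n) = 0 := by
    intro n
    induction n using Nat.strong_induction_on with
    | _ n ih =>
      intro i hi
      rw [he, map_sub, map_sum, hg0 i n hi, Finset.sum_eq_zero, sub_zero]
      intro k hk
      have hk := Finset.mem_range.1 hk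
      rw [map_smul, ih k hk i (hk.trans hi), smul_zero]
  have hdiag : ∀ n, g n (e n) = 1 := by
    intro n
    rw [he, map_sub, map_sum, hg1, Finset.sum_eq_zero, sub_zero]
    intro k hk
    rw [map_smul, hlow k n (Finset.mem_range.1 hk), smul_zero]
  have hup : ∀ n i, i < n → g i (e n) = 0 := by
    intro n
    induction n using Nat.strong_induction_on with
    | _ n ih =>
      intro i hi
      rw [he, map_sub, map_sum, Finset.sum_eq_single_of_mem i (Finset.mem_range.2 hi), map_smul,
        hdiag, smul_eq_mul, mul_one, sub_self]
      intro k hk hki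
      rw [map_smul]
      rcases lt_or_gt_of_ne hki with h | h
      · rw [hlow k i h, smul_zero]
      · rw [ih k (Finset.mem_range.1 hk) i h, smul_zero]
  refine ⟨e, g, fun i j => ?_, hd.mono ?_⟩
  · rcases lt_trichotomy i j with h | rfl | h
    · rw [hup j i h, if_neg h.ne]
    · rw [hdiag, if_pos rfl]
    · rw [hlow j i h, if_neg h.ne']
  · refine Submodule.span_le.2 ?_
    rintro _ ⟨n, rfl⟩
    have hvn : v n = e n + ∑ k ∈ Finset.range n, g k (v n) • e k := by rw [he n]; abel
    rw [hvn]
    exact add_mem (Submodule.subset_span ⟨n, rfl⟩)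
      (sum_mem fun k _ => Submodule.smul_mem _ _ (Submodule.subset_span ⟨k, rfl⟩))

/-- A weighted backward shift along a biorthogonal sequence. -/
lemma exists_weighted_backward_shift [CompleteSpace X] {e : ℕ → X} {g : ℕ → X →L[ℂ] ℂ}
    (h : ∀ i j, g i (e j) = if i = j then 1 else 0) :
    ∃ (T : X →L[ℂ] X) (w : ℕ → ℂ), (∀ n, w n ≠ 0) ∧ T (e 0) = 0 ∧
      ∀ n, T (e (n + 1)) = w n • e n := by
  let A : ℕ → X →L[ℂ] X := fun n => (g (n + 1)).smulRight (e n)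
  -- Nonzero weights small enough for the rank-one operators to sum in operator norm.
  let w : ℕ → ℂ := fun n => (((1 / 2 : ℝ) ^ n / (1 + ‖A n‖) : ℝ) : ℂ)
  have hpos : ∀ n, 0 < (1 / 2 : ℝ) ^ n / (1 + ‖A n‖) := fun n => by positivity
  have hsum : Summable fun n => w n • A n := by
    refine Summable.of_norm_bounded summable_geometric_two fun n => ?_
    rw [norm_smul, Complex.norm_real, Real.norm_of_nonneg (hpos n).le, div_mul_eq_mul_div,
      div_le_iff₀ (by positivity)]
    have : (0 : ℝ) ≤ (1 / 2) ^ n := by positivity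
    nlinarith
  have happly : ∀ x, (∑' n, w n • A n) x = ∑' n, (w n * g (n + 1) x) • e n := fun x => by
    have := (ContinuousLinearMap.apply ℂ X x).map_tsum hsum
    simp only [ContinuousLinearMap.apply_apply] at this
    rw [this]
    exact tsum_congr fun n => by simp [A, smul_smul]
  refine ⟨∑' n, w n • A n, w, fun n => Complex.ofReal_ne_zero.2 (hpos n).ne', ?_, fun n => ?_⟩
  · rw [happly]
    simp [h]
  · rw [happly, tsum_eq_single n]
    · simp [h]
    · intro k hk
      simp [h, hk]

lemma exists_dense_generalized_kernel [CompleteSpace X] [TopologicalSpace.SeparableSpace X]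
    (hX : ¬ FiniteDimensional ℂ X) :
    ∃ (T : X →L[ℂ] X) (D : Submodule ℂ X), Dense (D : Set X) ∧
      (∀ y ∈ D, ∃ z ∈ D, T z = y) ∧ ∀ y ∈ D, ∃ k, (T ^ k) y = 0 := by
  obtain ⟨e, g, hbi, hd⟩ := exists_biorthogonal_seq_dense_span hX
  obtain ⟨T, w, hw, hT0, hT⟩ := exists_weighted_backward_shift hbi
  refine ⟨T, Submodule.span ℂ (Set.range e), hd, fun y hy => ?_, fun y hy => ?_⟩
  · have hle : Submodule.span ℂ (Set.range e) ≤
        (Submodule.span ℂ (Set.range e)).map (T : X →ₗ[ℂ] X) := by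
      refine Submodule.span_le.2 ?_
      rintro _ ⟨n, rfl⟩
      refine ⟨(w n)⁻¹ • e (n + 1), Submodule.smul_mem _ _ (Submodule.subset_span ⟨_, rfl⟩), ?_⟩
      simp [hT, smul_smul, hw]
    exact hle hy
  · have hpow : ∀ n, (T ^ (n + 1)) (e n) = 0 := by
      intro n
      induction n with
      | zero => simpa using hT0
      | succ n ih => rw [pow_succ, mul_apply_eq_comp, hT, map_smul, ih, smul_zero]
    induction hy using Submodule.span_induction with
    | mem x hx =>
      obtain ⟨n, rfl⟩ := hx
      exact ⟨n + 1, hpow n⟩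
    | zero => exact ⟨0, map_zero _⟩
    | add x y _ _ hx hy =>
      obtain ⟨k, hk⟩ := hx
      obtain ⟨l, hl⟩ := hy
      exact ⟨k + l, by
        rw [map_add, pow_apply_eq_zero_of_le (by omega) hk, pow_apply_eq_zero_of_le (by omega) hl, add_zero]⟩
    | smul a x _ hx =>
      obtain ⟨k, hk⟩ := hx
      exact ⟨k, by rw [map_smul, hk, smul_zero]⟩

end Biorthogonal

end LinearDynamics

theorem corollary4p6 {X : Type*} [NormedAddCommGroup X] [NormedSpace ℂ X] [CompleteSpace X]
    [TopologicalSpace.SeparableSpace X] (hX : ¬ FiniteDimensional ℂ X)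
    (Γ : Set ℂ) (hΓ : ¬ Bornology.IsBounded Γ) :
    ∃ T : X →L[ℂ] X,
      LinearDynamics.FrequentlySupercyclic Γ T ∧
      LinearDynamics.UFrequentlySupercyclic Γ T ∧
      LinearDynamics.ReiterativelySupercyclic Γ T := by
  obtain ⟨T, D, hD, hsurj, hnil⟩ := LinearDynamics.exists_dense_generalized_kernel hX
  obtain ⟨x, hx⟩ :=
    LinearDynamics.frequentlySupercyclic_of_dense_generalized_kernel T D hD hsurj hnil hΓ
  exact ⟨T, ⟨x, hx⟩,
    ⟨x, fun U hU hne => LinearDynamics.posLowerDensity_subset_posUpperDensity (hx U hU hne)⟩,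
    ⟨x, fun U hU hne => LinearDynamics.posLowerDensity_subset_posUpperBanachDensity (hx U hU hne)⟩⟩
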